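/- Let $X$ be an order complete vector lattice, let $X^u$ be its universal completion (the universally complete, i.e. order complete and laterally complete, vector lattice containing $X$ as an order dense sublattice), and let $X^s$ be its sup-completion in the sense of Donner. That is, $X^s$ is an ordered cone (a commutative monoid with multiplication by scalars in $[0,\infty)$ satisfying the usual laws) whose group of invertible elements is $X$, with the operations and order of $X$, such that: 1. addition and multiplication by non-negative scalars are monotone; 2. $X^s$ is a lattice; 3. $X^s$ has a greatest element; 4. if $x\in X$, $a\in X^s$ and $a\le x$, then $a\in X$; 5. every non-empty subset of $X^s$ has a supremum, and every non-empty subset that is bounded below has an infimum; 6. $a=\sup\{x\in X: x\le a\}$ for every $a\in X^s$; 7. $a+(x\wedge b)=(a+x)\wedge(a+b)$ for all $a,b\in X^s$ and $x\in X$; 8. if $A,B\subseteq X^s$ are non-empty, $\sup A=\sup B$ and $x\in X$, then $\sup\{a\wedge x: a\in A\}=\sup\{b\wedge x: b\in B\}$. An element $u\in X^s$ is identified with an element $v\in X^u$, and we then write $u\in X^u$, if $\{x\in X: x\le u\}=\{x\in X: x\le v\}$. For $0\le a\in X^s$ let $P_a$ denote the band projection of $X$ onto the band $\{x\in X: |x|\wedge|y|=0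 \text{ for every } y\in X \text{ with } |y|\wedge a=0\}$ generated by $a$. Let $e\in X_+$ be a weak unit (that is, $e\ge 0$, and $e\wedge|x|=0$ implies $x=0$ for $x\in X$), and let $u\in X^s$. Then $$u\notin X^u \quad\Longleftrightarrow\quad \inf_{\lambda\in(0,\infty)} P_{(u-\lambda e)^+}\,e>0,$$ where the infimum is taken in $X$. -/

import Mathlib

open scoped NNReal

/-- The disjoint complement `Sᵈ` of a subset of a vector lattice. -/
def disjointComplement {X : Type*} [AddCommGroup X] [Lattice X] (S : Set X) : Set X :=
  {x | ∀ s ∈ S, |x| ⊓ |s| = 0}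

/-- The band projection onto a band `B` of an order complete vector lattice:
`P x = sup {y ∈ B | 0 ≤ y ≤ x}` for `x ≥ 0`, and `P x = P x⁺ - P x⁻` in general. -/
noncomputable def bandProjection {X : Type*} [AddCommGroup X] [ConditionallyCompleteLattice X]
    (B : Set X) (x : X) : X :=
  sSup {y | y ∈ B ∧ 0 ≤ y ∧ y ≤ x⁺} - sSup {y | y ∈ B ∧ 0 ≤ y ∧ y ≤ x⁻}

section BandProjection

variable {X : Type*} [AddCommGroup X] [ConditionallyCompleteLattice X] [IsOrderedAddMonoid X]

theorem inf_add_le_of_nonneg {a b c : X} (ha : 0 ≤ a) (hb : 0 ≤ b) (hc : 0 ≤ c) :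
    (a + b) ⊓ c ≤ a ⊓ c + b ⊓ c := by
  have h1 : (a + b) ⊓ c - b ⊓ c ≤ a ⊓ c := by
    rw [sub_le_iff_le_add, add_inf]
    refine le_inf ?_ (le_trans inf_le_right ?_)
    · rw [inf_add]
      exact le_inf inf_le_left (inf_le_right.trans (le_add_of_nonneg_right hb))
    · exact le_add_of_nonneg_left (le_inf ha hc)
  exact sub_le_iff_le_add.mp h1

theorem disjointComplement_of_abs_le {S : Set X} {x y z : X} (hx : x ∈ disjointComplement S)
    (hy : y ∈ disjointComplement S) (h : |z| ≤ |x| + |y|) : z ∈ disjointComplement S := by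
  intro s hs
  apply le_antisymm
  · calc |z| ⊓ |s| ≤ (|x| + |y|) ⊓ |s| := inf_le_inf_right _ h
      _ ≤ |x| ⊓ |s| + |y| ⊓ |s| :=
        inf_add_le_of_nonneg (abs_nonneg x) (abs_nonneg y) (abs_nonneg s)
      _ = 0 := by rw [hx s hs, hy s hs, add_zero]
  · exact le_inf (abs_nonneg z) (abs_nonneg s)

theorem zero_mem_disjointComplement (S : Set X) : (0 : X) ∈ disjointComplement S := by
  intro s _
  rw [abs_zero]
  exact inf_eq_left.mpr (abs_nonneg s)

theorem sSup_band_mem (S : Set X) {x : X} (hx : 0 ≤ x) :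
    0 ≤ sSup {y | y ∈ disjointComplement S ∧ 0 ≤ y ∧ y ≤ x} ∧
    sSup {y | y ∈ disjointComplement S ∧ 0 ≤ y ∧ y ≤ x} ∈ disjointComplement S ∧
    x - sSup {y | y ∈ disjointComplement S ∧ 0 ≤ y ∧ y ≤ x} ∈
      disjointComplement (disjointComplement S) := by
  set A := {y | y ∈ disjointComplement S ∧ 0 ≤ y ∧ y ≤ x} with hA
  have hne : A.Nonempty := ⟨0, zero_mem_disjointComplement S, le_rfl, hx⟩
  have hbdd : BddAbove A := ⟨x, fun y hy => hy.2.2⟩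
  have h0 : 0 ≤ sSup A := le_csSup hbdd ⟨zero_mem_disjointComplement S, le_rfl, hx⟩
  have hle : sSup A ≤ x := csSup_le hne fun y hy => hy.2.2
  have hmem : sSup A ∈ disjointComplement S := by
    intro s hs
    rw [abs_of_nonneg h0]
    have hz : 0 ≤ sSup A ⊓ |s| := le_inf h0 (abs_nonneg s)
    have key : sSup A ≤ sSup A - sSup A ⊓ |s| := by
      refine csSup_le hne fun y hy => ?_
      rw [le_sub_iff_add_le]
      have hd : y ⊓ (sSup A ⊓ |s|) = 0 := by
        apply le_antisymm _ (le_inf hy.2.1 hz)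
        have h2 := hy.1 s hs
        rw [abs_of_nonneg hy.2.1] at h2
        exact h2 ▸ inf_le_inf_left y inf_le_right
      have h3 := inf_add_sup y (sSup A ⊓ |s|)
      rw [hd, zero_add] at h3
      rw [← h3]
      exact sup_le (le_csSup hbdd hy) inf_le_left
    exact le_antisymm (by simpa using key) hz
  refine ⟨h0, hmem, fun b hb => ?_⟩
  have hnn : 0 ≤ x - sSup A := sub_nonneg.mpr hle
  rw [abs_of_nonneg hnn]
  have hz : 0 ≤ (x - sSup A) ⊓ |b| := le_inf hnn (abs_nonneg b)
  have hsum : sSup A + (x - sSup A) ⊓ |b| ∈ A := by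
    refine ⟨disjointComplement_of_abs_le hmem hb ?_, add_nonneg h0 hz, ?_⟩
    · rw [abs_of_nonneg (add_nonneg h0 hz), abs_of_nonneg h0]
      exact add_le_add le_rfl inf_le_right
    · rw [add_comm, ← le_sub_iff_add_le]
      exact inf_le_left
  have := le_csSup hbdd hsum
  exact le_antisymm (by simpa using this) hz

/-- `bandProjection` is the projection of `X = B ⊕ Bᵈ` onto `B`, for `B = Sᵈ`. -/
theorem bandProjection_spec (S : Set X) (x : X) :
    bandProjection (disjointComplement S) x ∈ disjointComplement S ∧
    x - bandProjection (disjointComplement S) x ∈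
      disjointComplement (disjointComplement S) := by
  obtain ⟨-, h1, h2⟩ := sSup_band_mem S (posPart_nonneg x)
  obtain ⟨-, h3, h4⟩ := sSup_band_mem S (negPart_nonneg x)
  have tri : ∀ a b : X, |a - b| ≤ |a| + |b| := fun a b => by
    simpa [sub_eq_add_neg] using abs_add_le a (-b)
  refine ⟨disjointComplement_of_abs_le h1 h3 (tri _ _), ?_⟩
  refine disjointComplement_of_abs_le h2 h4 ?_
  refine le_trans (le_of_eq ?_) (tri _ _)
  congr 1
  rw [sub_sub_sub_comm, posPart_sub_negPart]
  rfl

theorem bandProjection_nonneg (S : Set X) {x : X} (hx : 0 ≤ x) :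
    0 ≤ bandProjection (disjointComplement S) x := by
  have h : {y | y ∈ disjointComplement S ∧ 0 ≤ y ∧ y ≤ (0 : X)} = {0} := by
    ext y
    refine ⟨fun hy => le_antisymm hy.2.2 hy.2.1, ?_⟩
    rintro rfl
    exact ⟨zero_mem_disjointComplement S, le_rfl, le_rfl⟩
  unfold bandProjection
  rw [negPart_eq_zero.mpr hx, h, csSup_singleton, sub_zero]
  exact (sSup_band_mem S (posPart_nonneg x)).1

end BandProjection

/-- `e` is a weak unit: `e ≥ 0` and only `0` is disjoint from `e`. -/
def IsWeakUnit {X : Type*} [AddCommGroup X] [Lattice X] (e : X) : Prop :=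
  0 ≤ e ∧ ∀ x : X, e ⊓ |x| = 0 → x = 0

/-- The conditions on an ordered cone `C` under which it is a sup-completion of the group `C₀` of
its invertible elements. A cone is a commutative monoid with a multiplication by scalars from
`[0, ∞)`, that is, a module over the semiring `ℝ≥0`. The elements of `C₀` are those with
`IsAddUnit`. -/
structure IsSupCone (C : Type*) [AddCommMonoid C] [Module ℝ≥0 C] [Lattice C] : Prop where
  add_le_add_right' : ∀ a b c : C, a ≤ b → a + c ≤ b + c
  smul_le_smul' : ∀ (r : ℝ≥0) (a b : C), a ≤ b → r • a ≤ r • b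
  exists_greatest : ∃ t : C, ∀ a : C, a ≤ t
  ideal : ∀ a x : C, IsAddUnit x → a ≤ x → IsAddUnit a
  exists_sup : ∀ A : Set C, A.Nonempty → ∃ s, IsLUB A s
  exists_inf : ∀ A : Set C, A.Nonempty → BddBelow A → ∃ s, IsGLB A s
  order_dense : ∀ a : C, IsLUB {x : C | IsAddUnit x ∧ x ≤ a} a
  add_inf' : ∀ a b x : C, IsAddUnit x → a + x ⊓ b = (a + x) ⊓ (a + b)
  sup_inf_eq : ∀ A B : Set C, A.Nonempty → B.Nonempty → ∀ x : C, IsAddUnit x →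
    ∀ s : C, IsLUB A s → IsLUB B s →
      ∀ p q : C, IsLUB ((fun a => a ⊓ x) '' A) p → IsLUB ((fun b => b ⊓ x) '' B) q → p = q

/-- `C` is a sup-completion of the vector lattice `X`: it satisfies the conditions above, and `ι`
identifies `X`, with its operations and order, with the invertible elements of `C`. -/
structure IsSupCompletion {X C : Type*} [AddCommGroup X] [Module ℝ X] [Lattice X]
    [AddCommMonoid C] [Module ℝ≥0 C] [Lattice C] (ι : X → C) : Prop where
  isSupCone : IsSupCone C
  map_add : ∀ x y : X, ι (x + y) = ι x + ι y
  map_smul : ∀ (r : ℝ≥0) (x : X), ι ((r : ℝ) • x) = r • ι x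
  le_iff_le : ∀ x y : X, ι x ≤ ι y ↔ x ≤ y
  range_eq : Set.range ι = {a : C | IsAddUnit a}

/-- `U` is a universal completion of the vector lattice `X`: it is order complete (through its
instance `ConditionallyCompleteLattice U`) and laterally complete, and `j` identifies `X` with an
order dense vector sublattice of `U`. -/
structure IsUniversalCompletion {X U : Type*} [AddCommGroup X] [Module ℝ X] [Lattice X]
    [AddCommGroup U] [Module ℝ U] [ConditionallyCompleteLattice U] (j : X →ₗ[ℝ] U) : Prop where
  injective : Function.Injective j
  map_sup : ∀ x y : X, j (x ⊔ y) = j x ⊔ j y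
  order_dense : ∀ v : U, 0 < v → ∃ x : X, 0 < j x ∧ j x ≤ v
  laterally_complete : ∀ A : Set U, A.Nonempty → (∀ a ∈ A, 0 ≤ a) →
    A.Pairwise (fun a b => a ⊓ b = 0) → ∃ s, IsLUB A s

/-- The element `u` of the sup-completion `C` of `X` lies in the universal completion `U` of `X`:
some `v` in `U` dominates exactly the same elements of `X` as `u` does. (An element of `C` is the
supremum of the elements of `X` below it, and so is each element of `U` that dominates an element
of `X`; thus `v` and `u` are the suprema in `U` and in `C` of the same set in `X`.) -/
def LiesInUniversalCompletion {X C U : Type*} [LE C] [LE U] (ι : X → C) (j : X → U) (u : C) :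
    Prop :=
  ∃ v : U, ∀ x : X, ι x ≤ u ↔ j x ≤ v

/-- The band of `X` generated by an element `a ≥ 0` of the sup-completion `C` of `X`: the disjoint
complement in `X` of the set of all `y` in `X` that are disjoint from `a`. -/
def principalBand {X C : Type*} [AddCommGroup X] [Lattice X] [AddCommMonoid C] [Lattice C]
    (ι : X → C) (a : C) : Set X :=
  disjointComplement {y : X | ι |y| ⊓ a = 0}

/-!
Write `P t` for the projection onto the band generated by `(u - t e)⁺`, and `p` for the infimum of
the elements `P t e`.

If `u` is represented by `v` in `U`, then `p = 0`. Indeed `n • P n e ≤ u ⊔ 0` for every `n`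
(`nsmul_bandProjection_le`): the excess of `n • P n e` over `u ⊔ 0` lies in the band of
`(u - n e)⁺`, and it is disjoint from `(u - n e)⁺` by `sup_inf_eq`. With `w = u ⊓ 0`, an element of `X`,
we have `u ⊔ 0 ≤ u - w`, whence `n • p + w ≤ u`. In `U` this reads `n • j p ≤ v - j w` for
all `n`, so `p = 0` by the Archimedean property.

Conversely let `p = 0`. The elements `g n = e - P n e` increase, the elements
`f 0 = g 1` and `f n = g (n + 1) - g n` for `n ≥ 1` are disjoint, and on the part of `X` carried by
`f n` every `x ≤ u` is at most `(n + 1) • e`. By lateral completeness the elements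
`(n + 1) • j (f n)` have a supremum in `U`. It bounds `{j x | x ≤ u}` from above
(`bddAbove_of_forall_le_bandProjection`): an excess over it would be disjoint from every `f n`, and
so would be carried by every `P n e`, while these have infimum `0`.
The supremum `v` of `{j x | x ≤ u}` in `U` then represents `u`
(`liesInUniversalCompletion_of_bddAbove`).
-/

/-! ### Order complete vector lattices -/

section LatticeGroup

variable {X : Type*} [AddCommGroup X] [Lattice X]

theorem eq_zero_of_mem_disjointComplement [IsOrderedAddMonoid X] {S : Set X} {x : X} (hx : x ∈ S)
    (hx' : x ∈ disjointComplement S) : x = 0 := by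
  have h : |x| = 0 := by simpa using hx' x hx
  exact le_antisymm ((le_abs_self x).trans h.le) (neg_nonpos.1 ((neg_le_abs x).trans h.le))

theorem disjointComplement_anti {S T : Set X} (h : S ⊆ T) :
    disjointComplement T ⊆ disjointComplement S :=
  fun _ hx s hs => hx s (h hs)

theorem inf_eq_zero_of_le {a b c d : X} (ha : 0 ≤ a) (hb : 0 ≤ b) (hac : a ≤ c) (hbd : b ≤ d)
    (h : c ⊓ d = 0) : a ⊓ b = 0 :=
  le_antisymm (h ▸ inf_le_inf hac hbd) (le_inf ha hb)

end LatticeGroup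

section CompleteLatticeGroup

variable {X : Type*} [AddCommGroup X] [ConditionallyCompleteLattice X] [IsOrderedAddMonoid X]

theorem add_inf_eq_zero {a b c : X} (ha : 0 ≤ a) (hb : 0 ≤ b) (hc : 0 ≤ c)
    (hac : a ⊓ c = 0) (hbc : b ⊓ c = 0) : (a + b) ⊓ c = 0 := by
  refine le_antisymm ?_ (le_inf (add_nonneg ha hb) hc)
  simpa [hac, hbc] using inf_add_le_of_nonneg ha hb hc

theorem nsmul_inf_eq_zero {a c : X} (ha : 0 ≤ a) (hc : 0 ≤ c) (hac : a ⊓ c = 0) (n : ℕ) :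
    (n • a) ⊓ c = 0 := by
  induction n with
  | zero => simpa using hc
  | succ n ih => rw [succ_nsmul]; exact add_inf_eq_zero (nsmul_nonneg ha n) ha hc ih hac

theorem nsmul_mem_disjointComplement {S : Set X} {x : X} (h0 : 0 ≤ x)
    (hx : x ∈ disjointComplement S) (n : ℕ) : n • x ∈ disjointComplement S := by
  intro s hs
  have h := hx s hs
  rw [abs_of_nonneg h0] at h
  rw [abs_of_nonneg (nsmul_nonneg h0 n)]
  exact nsmul_inf_eq_zero h0 (abs_nonneg s) h n

/-- An order complete lattice-ordered group is Archimedean. -/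
theorem nonpos_of_forall_nsmul_le {b w : X} (h : ∀ n : ℕ, n • b ≤ w) : b ≤ 0 := by
  have hbdd : BddAbove (Set.range fun n : ℕ => n • b) := ⟨w, by rintro _ ⟨n, rfl⟩; exact h n⟩
  have : (⨆ n : ℕ, n • b) ≤ (⨆ n : ℕ, n • b) - b := by
    refine ciSup_le fun n => ?_
    rw [le_sub_iff_add_le, ← succ_nsmul]
    exact le_ciSup hbdd (n + 1)
  simpa using this

theorem IsLUB.inf_le_of_forall_inf_le {D : Set X} {s a b : X} (hs : IsLUB D s)
    (h : ∀ d ∈ D, a ⊓ d ≤ b) : a ⊓ s ≤ b := by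
  have h1 : s ≤ b + a ⊔ s - a := by
    refine hs.2 fun d hd => ?_
    rw [le_sub_iff_add_le, add_comm, ← inf_add_sup a d]
    exact add_le_add (h d hd) (sup_le_sup_left (hs.1 hd) a)
  rw [le_sub_iff_add_le, add_comm, ← inf_add_sup a s] at h1
  exact le_of_add_le_add_right h1

theorem bandProjection_of_nonneg (S : Set X) {x : X} (hx : 0 ≤ x) :
    bandProjection (disjointComplement S) x =
      sSup {y | y ∈ disjointComplement S ∧ 0 ≤ y ∧ y ≤ x} := by
  have h : {y | y ∈ disjointComplement S ∧ 0 ≤ y ∧ y ≤ (0 : X)} = {0} := by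
    ext y
    refine ⟨fun hy => le_antisymm hy.2.2 hy.2.1, ?_⟩
    rintro rfl
    exact ⟨zero_mem_disjointComplement S, le_rfl, le_rfl⟩
  rw [bandProjection, negPart_eq_zero.mpr hx, posPart_of_nonneg hx, h, csSup_singleton, sub_zero]

theorem bandProjection_le_self (S : Set X) {x : X} (hx : 0 ≤ x) :
    bandProjection (disjointComplement S) x ≤ x := by
  rw [bandProjection_of_nonneg S hx]
  exact csSup_le ⟨0, zero_mem_disjointComplement S, le_rfl, hx⟩ fun y hy => hy.2.2

theorem bandProjection_anti {S T : Set X} (h : S ⊆ T) {x : X} (hx : 0 ≤ x) :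
    bandProjection (disjointComplement T) x ≤ bandProjection (disjointComplement S) x := by
  rw [bandProjection_of_nonneg S hx, bandProjection_of_nonneg T hx]
  exact csSup_le_csSup ⟨x, fun y hy => hy.2.2⟩ ⟨0, zero_mem_disjointComplement T, le_rfl, hx⟩
    fun y hy => ⟨disjointComplement_anti h hy.1, hy.2⟩

/-- If `f` is a component of `e` disjoint from `(x - n e)⁺`, then `x ≤ n f` on the part of `X`
carried by `f`. -/
theorem posPart_sub_nsmul_inf_eq_zero {e f x : X} {n : ℕ} (hf : 0 ≤ f) (hfe : f ≤ e)
    (hcomp : (e - f) ⊓ f = 0) (h : (x - n • e)⁺ ⊓ f = 0) : (x - n • f)⁺ ⊓ f = 0 := by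
  have he : 0 ≤ e - f := sub_nonneg.2 hfe
  refine inf_eq_zero_of_le (posPart_nonneg _) hf ?_ le_rfl
    (add_inf_eq_zero (posPart_nonneg (x - n • e)) (nsmul_nonneg he n) hf h
      (nsmul_inf_eq_zero he hf hcomp n))
  refine sup_le ?_ (add_nonneg (posPart_nonneg _) (nsmul_nonneg he n))
  calc x - n • f = (x - n • e) + n • (e - f) := by rw [nsmul_sub]; abel
    _ ≤ _ := add_le_add_left (le_posPart _) _

end CompleteLatticeGroup

/-! ### The embeddings into the two completions -/

namespace IsUniversalCompletion

variable {X U : Type*} [AddCommGroup X] [Module ℝ X] [Lattice X]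
    [AddCommGroup U] [Module ℝ U] [ConditionallyCompleteLattice U] {j : X →ₗ[ℝ] U}

theorem map_le_iff (hj : IsUniversalCompletion j) {x y : X} : j x ≤ j y ↔ x ≤ y := by
  rw [← sup_eq_right, ← sup_eq_right, ← hj.map_sup, hj.injective.eq_iff]

theorem map_nonneg (hj : IsUniversalCompletion j) {x : X} : 0 ≤ j x ↔ 0 ≤ x := by
  rw [← map_zero j, hj.map_le_iff]

theorem map_inf [IsOrderedAddMonoid X] [IsOrderedAddMonoid U] (hj : IsUniversalCompletion j)
    (x y : X) : j (x ⊓ y) = j x ⊓ j y := by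
  rw [← neg_inj, ← map_neg, neg_inf, neg_inf, hj.map_sup, map_neg, map_neg]

end IsUniversalCompletion

namespace IsSupCompletion

variable {X C : Type*} [AddCommGroup X] [Module ℝ X] [Lattice X]
    [AddCommMonoid C] [Module ℝ≥0 C] [Lattice C] {ι : X → C}

theorem map_zero (hι : IsSupCompletion ι) : ι 0 = 0 := by
  simpa using hι.map_smul 0 0

theorem isAddUnit (hι : IsSupCompletion ι) (x : X) : IsAddUnit (ι x) :=
  (hι.range_eq ▸ Set.mem_range_self x : ι x ∈ {a : C | IsAddUnit a})

theorem exists_eq_of_le (hι : IsSupCompletion ι) {a : C} {x : X} (h : a ≤ ι x) :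
    ∃ z, ι z = a := by
  have ha : a ∈ {a : C | IsAddUnit a} := hι.isSupCone.ideal a (ι x) (hι.isAddUnit x) h
  rwa [← hι.range_eq] at ha

theorem map_sup (hι : IsSupCompletion ι) (x y : X) : ι (x ⊔ y) = ι x ⊔ ι y := by
  have hle : ι x ⊔ ι y ≤ ι (x ⊔ y) :=
    sup_le ((hι.le_iff_le _ _).2 le_sup_left) ((hι.le_iff_le _ _).2 le_sup_right)
  obtain ⟨z, hz⟩ := hι.exists_eq_of_le hle
  refine le_antisymm ?_ hle
  rw [← hz, hι.le_iff_le]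
  exact sup_le ((hι.le_iff_le _ _).1 (hz ▸ le_sup_left)) ((hι.le_iff_le _ _).1 (hz ▸ le_sup_right))

theorem map_inf (hι : IsSupCompletion ι) (x y : X) : ι (x ⊓ y) = ι x ⊓ ι y := by
  have hle : ι (x ⊓ y) ≤ ι x ⊓ ι y :=
    le_inf ((hι.le_iff_le _ _).2 inf_le_left) ((hι.le_iff_le _ _).2 inf_le_right)
  obtain ⟨z, hz⟩ := hι.exists_eq_of_le (inf_le_left : ι x ⊓ ι y ≤ ι x)
  refine le_antisymm hle ?_
  rw [← hz, hι.le_iff_le]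
  exact le_inf ((hι.le_iff_le _ _).1 (hz ▸ inf_le_left)) ((hι.le_iff_le _ _).1 (hz ▸ inf_le_right))

theorem map_nonneg (hι : IsSupCompletion ι) {x : X} : 0 ≤ ι x ↔ 0 ≤ x := by
  rw [← hι.map_zero, hι.le_iff_le]

theorem le_add_map_iff (hι : IsSupCompletion ι) {a b : C} {x : X} :
    a ≤ b + ι x ↔ a + ι (-x) ≤ b := by
  constructor <;> intro h
  · simpa [add_assoc, ← hι.map_add, hι.map_zero] using
      hι.isSupCone.add_le_add_right' _ _ (ι (-x)) h
  · simpa [add_assoc, ← hι.map_add, hι.map_zero] using hι.isSupCone.add_le_add_right' _ _ (ι x) h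

theorem exists_map_eq_inf_zero (hι : IsSupCompletion ι) (u : C) : ∃ w : X, ι w = u ⊓ 0 :=
  hι.exists_eq_of_le (hι.map_zero ▸ inf_le_right : u ⊓ 0 ≤ ι 0)

theorem le_of_forall_map_le (hι : IsSupCompletion ι) {u b : C}
    (h : ∀ x : X, ι x ≤ u → ι x ≤ b) : u ≤ b := by
  refine (hι.isSupCone.order_dense u).2 ?_
  rintro a ⟨ha, hau⟩
  obtain ⟨x, rfl⟩ : a ∈ Set.range ι := by rw [hι.range_eq]; exact ha
  exact h x hau

/-- Meets with elements of `X` distribute over suprema in the sup-completion. This is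
`IsSupCone.sup_inf_eq` for the pair of sets `A` and `{s}`. -/
theorem inf_map_le_of_isLUB (hι : IsSupCompletion ι) {A : Set C} (hA : A.Nonempty) {s b : C}
    (hs : IsLUB A s) {x : X} (h : ∀ a ∈ A, a ⊓ ι x ≤ b) : s ⊓ ι x ≤ b := by
  obtain ⟨p, hp⟩ := hι.isSupCone.exists_sup ((fun a => a ⊓ ι x) '' A) (hA.image _)
  have hps : p = s ⊓ ι x :=
    hι.isSupCone.sup_inf_eq A {s} hA (Set.singleton_nonempty s) (ι x) (hι.isAddUnit x) s hs
      isLUB_singleton p _ hp (by rw [Set.image_singleton]; exact isLUB_singleton)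
  rw [← hps]
  exact hp.2 (by rintro _ ⟨a, ha, rfl⟩; exact h a ha)

/-- `(u - y)⁺` is the supremum of the elements `(x - y)⁺` with `x ∈ X` and `x ≤ u`. -/
theorem isLUB_posPart_sub (hι : IsSupCompletion ι) (u : C) (y : X) :
    IsLUB ((fun x => ι (x - y)⁺) '' {x | ι x ≤ u}) ((u + ι (-y)) ⊔ 0) := by
  constructor
  · rintro _ ⟨x, hx, rfl⟩
    simp only [posPart_def, hι.map_sup, hι.map_zero, sub_eq_add_neg, hι.map_add]
    exact sup_le_sup_right (hι.isSupCone.add_le_add_right' _ _ _ hx) 0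
  · intro b hb
    have hx : ∀ x, ι x ≤ u → ι (x - y)⁺ ≤ b := fun x hx => hb ⟨x, hx, rfl⟩
    refine sup_le ?_ ?_
    · rw [← hι.le_add_map_iff]
      refine hι.le_of_forall_map_le fun x hxu => ?_
      rw [hι.le_add_map_iff, ← hι.map_add, ← sub_eq_add_neg]
      exact ((hι.le_iff_le _ _).2 (le_posPart _)).trans (hx x hxu)
    · obtain ⟨w, hw⟩ := hι.exists_map_eq_inf_zero u
      exact (hι.map_nonneg.2 (posPart_nonneg _)).trans (hx w (hw ▸ inf_le_left))

end IsSupCompletion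

/-! ### Spectral projections of an element of the sup-completion -/

section Spectral

variable {X C : Type*} [AddCommGroup X] [Module ℝ X] [ConditionallyCompleteLattice X]
    [IsOrderedAddMonoid X] [AddCommMonoid C] [Module ℝ≥0 C] [Lattice C] {ι : X → C}

theorem bandProjection_principalBand_mono (hι : IsSupCompletion ι) {a b : C} (ha : 0 ≤ a)
    (hab : a ≤ b) {x : X} (hx : 0 ≤ x) :
    bandProjection (principalBand ι a) x ≤ bandProjection (principalBand ι b) x :=
  bandProjection_anti (fun y (hy : ι |y| ⊓ b = 0) => le_antisymm
    (hy ▸ inf_le_inf_left _ hab) (le_inf (hι.map_nonneg.2 (abs_nonneg y)) ha)) hx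

theorem bandProjection_spectral_anti (hι : IsSupCompletion ι) (u : C) {x y e : X} (hxy : x ≤ y)
    (he : 0 ≤ e) :
    bandProjection (principalBand ι ((u + ι (-y)) ⊔ 0)) e ≤
      bandProjection (principalBand ι ((u + ι (-x)) ⊔ 0)) e := by
  refine bandProjection_principalBand_mono hι le_sup_right (sup_le_sup_right ?_ 0) he
  rw [add_comm u, add_comm u]
  exact hι.isSupCone.add_le_add_right' _ _ _ ((hι.le_iff_le _ _).2 (neg_le_neg hxy))

theorem posPart_sub_mem_principalBand (hι : IsSupCompletion ι) {u : C} {x y : X}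
    (hx : ι x ≤ u) : (x - y)⁺ ∈ principalBand ι ((u + ι (-y)) ⊔ 0) := by
  intro s (hs : ι |s| ⊓ _ = 0)
  refine le_antisymm ?_ (le_inf (abs_nonneg _) (abs_nonneg _))
  rw [abs_of_nonneg (posPart_nonneg _), ← hι.le_iff_le, hι.map_inf, hι.map_zero, inf_comm, ← hs]
  exact inf_le_inf_left _ ((hι.isLUB_posPart_sub u y).1 ⟨x, hx, rfl⟩)

/-- Chebyshev's inequality: the projection of `n e` onto the band of `(u - n e)⁺` is at most
`u⁺`. -/
theorem nsmul_bandProjection_le (hι : IsSupCompletion ι) {e : X} (he : 0 ≤ e) (u : C) (n : ℕ) :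
    ι (n • bandProjection (principalBand ι ((u + ι (-(n • e))) ⊔ 0)) e) ≤ u ⊔ 0 := by
  set a := (u + ι (-(n • e))) ⊔ 0 with ha
  set P := bandProjection (principalBand ι a) e
  have hP0 : 0 ≤ P := bandProjection_nonneg _ he
  have hPe : P ≤ e := bandProjection_le_self _ he
  have hq : n • P ∈ principalBand ι a :=
    nsmul_mem_disjointComplement hP0 (bandProjection_spec _ e).1 n
  obtain ⟨z, hz⟩ := hι.exists_eq_of_le (inf_le_right : (u ⊔ 0) ⊓ ι (n • P) ≤ ι (n • P))
  have hz0 : 0 ≤ z := by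
    rw [← hι.map_nonneg, hz]
    exact le_inf le_sup_right (hι.map_nonneg.2 (nsmul_nonneg hP0 n))
  have hzq : z ≤ n • P := by rw [← hι.le_iff_le, hz]; exact inf_le_right
  have hr0 : 0 ≤ n • P - z := sub_nonneg.2 hzq
  have hrS : n • P - z ∈ {y : X | ι |y| ⊓ a = 0} := by
    rw [Set.mem_ofPred_eq, abs_of_nonneg hr0, inf_comm]
    refine le_antisymm ?_ (le_inf le_sup_right (hι.map_nonneg.2 hr0))
    obtain ⟨w, hw⟩ := hι.exists_map_eq_inf_zero u
    refine hι.inf_map_le_of_isLUB (Set.Nonempty.image _ ⟨w, ?_⟩)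
      (hι.isLUB_posPart_sub u (n • e)) ?_
    · exact (hw ▸ inf_le_left : ι w ≤ u)
    rintro _ ⟨x, hx : ι x ≤ u, rfl⟩
    have hxz : x ⊓ n • P ≤ z := by
      rw [← hι.le_iff_le, hι.map_inf, hz]
      exact inf_le_inf_right _ (hx.trans le_sup_left)
    have hr : n • P - z ≤ (x - n • e)⁻ := by
      calc n • P - z ≤ n • P - x ⊓ n • P := sub_le_sub_left hxz _
        _ = (n • P - x) ⊔ 0 := by rw [sub_inf, sub_self]
        _ ≤ (n • e - x) ⊔ 0 := sup_le_sup_right (sub_le_sub_right (nsmul_le_nsmul_right hPe n) x) 0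
        _ = (x - n • e)⁻ := by rw [negPart_def, neg_sub]
    rw [← hι.map_inf, ← hι.map_zero, hι.le_iff_le]
    exact (inf_le_inf_left _ hr).trans (posPart_inf_negPart_eq_zero _).le
  have hr : n • P - z = 0 := by
    refine eq_zero_of_mem_disjointComplement hrS
      (disjointComplement_of_abs_le hq (zero_mem_disjointComplement _) ?_)
    rw [abs_of_nonneg hr0, abs_of_nonneg (nsmul_nonneg hP0 n), abs_zero, add_zero]
    exact sub_le_self _ hz0
  rw [sub_eq_zero.1 hr, hz]
  exact inf_le_left

end Spectral

/-! ### Membership in the universal completion -/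

section Completion

variable {X C U : Type*} [AddCommGroup X] [Module ℝ X] [ConditionallyCompleteLattice X]
    [IsOrderedAddMonoid X] [AddCommMonoid C] [Module ℝ≥0 C] [Lattice C]
    [AddCommGroup U] [Module ℝ U] [ConditionallyCompleteLattice U] [IsOrderedAddMonoid U]
    {ι : X → C} {j : X →ₗ[ℝ] U}

theorem LiesInUniversalCompletion.nonpos_of_forall_le (hι : IsSupCompletion ι)
    (hj : IsUniversalCompletion j) {e p : X} (he : 0 ≤ e) {u : C}
    (hu : LiesInUniversalCompletion ι j u)
    (hp : ∀ n : ℕ, p ≤ bandProjection (principalBand ι ((u + ι (-((n + 1) • e))) ⊔ 0)) e) :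
    p ≤ 0 := by
  obtain ⟨v, hv⟩ := hu
  obtain ⟨w, hw⟩ := hι.exists_map_eq_inf_zero u
  have hw0 : w ≤ 0 := by rw [← hι.le_iff_le, hw, hι.map_zero]; exact inf_le_right
  have hwu : ι w ≤ u := hw ▸ inf_le_left
  have hsup : u ⊔ 0 ≤ u + ι (-w) := by
    refine sup_le ?_ ?_
    · simpa [hι.map_zero, add_comm] using
        hι.isSupCone.add_le_add_right' _ _ u ((hι.le_iff_le _ _).2 (neg_nonneg.2 hw0))
    · rwa [hι.le_add_map_iff, neg_neg, zero_add]
  have key : ∀ n : ℕ, (n + 1) • j p ≤ v - j w := by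
    intro n
    rw [le_sub_iff_add_le, ← map_nsmul, ← map_add, ← hv, hι.map_add]
    have h := ((hι.le_iff_le _ _).2 (nsmul_le_nsmul_right (hp n) (n + 1))).trans
      ((nsmul_bandProjection_le hι he u (n + 1)).trans hsup)
    rwa [hι.le_add_map_iff, neg_neg] at h
  rw [← hj.map_le_iff, map_zero]
  refine nonpos_of_forall_nsmul_le (w := v - j w - j p) fun n => ?_
  rw [le_sub_iff_add_le, ← succ_nsmul]
  exact key n

/-- The supremum in `U` of the elements of `X` below `u` dominates no other elements of `X`. -/
theorem liesInUniversalCompletion_of_bddAbove (hι : IsSupCompletion ι)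
    (hj : IsUniversalCompletion j) {u : C} (h : BddAbove (j '' {x | ι x ≤ u})) :
    LiesInUniversalCompletion ι j u := by
  obtain ⟨w, hw⟩ := hι.exists_map_eq_inf_zero u
  have hwu : ι w ≤ u := hw ▸ inf_le_left
  have hlub : IsLUB (j '' {x | ι x ≤ u}) (sSup (j '' {x | ι x ≤ u})) :=
    isLUB_csSup (Set.Nonempty.image _ ⟨w, hwu⟩) h
  refine ⟨_, fun x => ⟨fun hx => hlub.1 ⟨x, hx, rfl⟩, fun hx => ?_⟩⟩
  -- `z = x ⊓ u` dominates `x ⊓ y` for all `y ≤ u`, so distributivity in `U` gives `x ≤ z`.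
  obtain ⟨z, hz⟩ := hι.exists_eq_of_le (inf_le_left : ι x ⊓ u ≤ ι x)
  have hxz : j x ≤ j z := by
    rw [← inf_eq_left.2 hx]
    refine hlub.inf_le_of_forall_inf_le ?_
    rintro _ ⟨y, hy, rfl⟩
    rw [← hj.map_inf, hj.map_le_iff, ← hι.le_iff_le, hι.map_inf, hz]
    exact inf_le_inf_left _ hy
  exact ((hι.le_iff_le _ _).2 (hj.map_le_iff.1 hxz)).trans (hz ▸ inf_le_right)

/-- If the spectral projections of `e` decrease to `0`, then the elements of `X` below `u` are
bounded above in the universal completion. -/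
theorem bddAbove_of_forall_le_bandProjection (hι : IsSupCompletion ι)
    (hj : IsUniversalCompletion j) {e : X} (he : IsWeakUnit e) {u : C}
    (h : ∀ y : X,
      (∀ n : ℕ, y ≤ bandProjection (principalBand ι ((u + ι (-(n • e))) ⊔ 0)) e) → y ≤ 0) :
    BddAbove (j '' {x | ι x ≤ u}) := by
  set P : ℕ → X := fun n => bandProjection (principalBand ι ((u + ι (-(n • e))) ⊔ 0)) e with hP
  have hP0 : ∀ n, 0 ≤ P n := fun n => bandProjection_nonneg _ he.1
  have hPe : ∀ n, P n ≤ e := fun n => bandProjection_le_self _ he.1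
  have hanti : Antitone P := fun m n hmn =>
    bandProjection_spectral_anti hι u (nsmul_le_nsmul_left he.1 hmn) he.1
  have hg0 : ∀ n, 0 ≤ e - P n := fun n => sub_nonneg.2 (hPe n)
  have hdisj : ∀ n, ∀ z ∈ principalBand ι ((u + ι (-(n • e))) ⊔ 0), 0 ≤ z →
      (e - P n) ⊓ z = 0 := by
    intro n z hz hz0
    have := (bandProjection_spec {y : X | ι |y| ⊓ ((u + ι (-(n • e))) ⊔ 0) = 0} e).2 z hz
    rw [abs_of_nonneg hz0] at this
    rwa [← abs_of_nonneg (hg0 n)]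
  have hcomp : ∀ n, (e - P n) ⊓ P n = 0 := fun n =>
    hdisj n _ (bandProjection_spec _ e).1 (hP0 n)
  -- `P n - P (n + 1)` is the component of `e` on which `n e ≤ u ≤ (n + 1) e`. For `n = 0` the
  -- part `e - P 0`, on which `u ≤ 0`, is added.
  set f : ℕ → X := fun n => (if n = 0 then e else P n) - P (n + 1) with hf
  have hf0 : ∀ n, 0 ≤ f n := by
    intro n
    rcases n with _ | n
    · exact hg0 _
    · exact sub_nonneg.2 (hanti (Nat.le_succ _))
  have hfg : ∀ n, f n ≤ e - P (n + 1) := by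
    intro n
    refine sub_le_sub_right ?_ _
    split_ifs
    exacts [le_rfl, hPe n]
  have hfe : ∀ n, f n ≤ e := fun n => (hfg n).trans (sub_le_self _ (hP0 _))
  have hff : ∀ m n, m < n → f m ⊓ f n = 0 := by
    intro m n hmn
    refine inf_eq_zero_of_le (hf0 m) (hf0 n)
      ((hfg m).trans (sub_le_sub_left (hanti hmn) e)) ?_ (hcomp n)
    rw [hf]
    simp only [if_neg (show n ≠ 0 by omega)]
    exact sub_le_self _ (hP0 _)
  have hfne : ∀ m n, m ≠ n → f m ⊓ f n = 0 := by
    intro m n hmn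
    rcases lt_or_gt_of_ne hmn with h | h
    · exact hff m n h
    · rw [inf_comm]; exact hff n m h
  have hsum : ∀ n, ∑ k ∈ Finset.range (n + 1), f k = e - P (n + 1) := by
    intro n
    induction n with
    | zero => simp [hf]
    | succ n ih => rw [Finset.sum_range_succ, ih, hf]; simp
  have hfcomp : ∀ n, (e - f n) ⊓ f n = 0 := by
    intro n
    have hsplit : e - f n = P (n + 1) + (e - P (n + 1) - f n) := by abel
    rw [hsplit]
    refine add_inf_eq_zero (hP0 _) (sub_nonneg.2 (hfg n)) (hf0 n) ?_ ?_
    · rw [inf_comm]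
      exact inf_eq_zero_of_le (hf0 n) (hP0 _) (hfg n) le_rfl (hcomp _)
    · rcases n with _ | n
      · simpa [hf] using hf0 0
      · have : e - P (n + 1 + 1) - f (n + 1) = e - P (n + 1) := by simp [hf]
        rw [this]
        refine inf_eq_zero_of_le (hg0 _) (hf0 _) le_rfl ?_ (hcomp (n + 1))
        simpa [hf] using hP0 (n + 1 + 1)
  obtain ⟨s, hs⟩ := hj.laterally_complete (Set.range fun n => j ((n + 1) • f n))
    (Set.range_nonempty _) (by
      rintro _ ⟨n, rfl⟩
      exact hj.map_nonneg.2 (nsmul_nonneg (hf0 n) _)) (by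
      rintro _ ⟨m, rfl⟩ _ ⟨n, rfl⟩ hmn
      have hne : m ≠ n := fun h => hmn (h ▸ rfl)
      change j _ ⊓ j _ = 0
      rw [← hj.map_inf, nsmul_inf_eq_zero (hf0 m) (nsmul_nonneg (hf0 n) _), map_zero]
      rw [inf_comm]
      exact nsmul_inf_eq_zero (hf0 n) (hf0 m) (hfne n m hne.symm) _)
  refine ⟨s, ?_⟩
  rintro _ ⟨x, hx : ι x ≤ u, rfl⟩
  by_contra hxs
  have hpos : 0 < (j x - s)⁺ := by
    refine lt_of_le_of_ne (posPart_nonneg _) fun h0 => hxs ?_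
    exact sub_nonpos.1 (posPart_eq_zero.1 h0.symm)
  obtain ⟨y, hy0, hy⟩ := hj.order_dense _ hpos
  have hy0' : 0 ≤ y := hj.map_nonneg.1 hy0.le
  have hyf : ∀ n, y ⊓ f n = 0 := by
    intro n
    refine inf_eq_zero_of_le hy0' (hf0 n) ?_ le_rfl
      (posPart_sub_nsmul_inf_eq_zero (x := x) (n := n + 1) (hf0 n) (hfe n) (hfcomp n) ?_)
    · rw [← hj.map_le_iff, posPart_def, hj.map_sup, map_zero, map_sub]
      exact hy.trans (sup_le_sup_right (sub_le_sub_left (hs.1 ⟨n, rfl⟩) _) 0)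
    · rw [inf_comm]
      exact inf_eq_zero_of_le (hf0 n) (posPart_nonneg _) (hfg n) le_rfl
        (hdisj (n + 1) _ (posPart_sub_mem_principalBand hι hx) (posPart_nonneg _))
  have hyg : ∀ n, (e - P (n + 1)) ⊓ y = 0 := by
    intro n
    rw [← hsum]
    induction n + 1 with
    | zero => simpa using hy0'
    | succ k ih =>
      rw [Finset.sum_range_succ]
      exact add_inf_eq_zero (Finset.sum_nonneg fun i _ => hf0 i) (hf0 k) hy0' ih
        (by rw [inf_comm]; exact hyf k)
  have hyP : ∀ n, e ⊓ y ≤ P n := by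
    intro n
    refine le_trans ?_ (hanti (Nat.le_succ n))
    calc e ⊓ y = ((e - P (n + 1)) + P (n + 1)) ⊓ y := by rw [sub_add_cancel]
      _ ≤ (e - P (n + 1)) ⊓ y + P (n + 1) ⊓ y := inf_add_le_of_nonneg (hg0 _) (hP0 _) hy0'
      _ ≤ P (n + 1) := by rw [hyg, zero_add]; exact inf_le_left
  have hey : e ⊓ |y| = 0 := by
    rw [abs_of_nonneg hy0']
    exact le_antisymm (h _ hyP) (le_inf he.1 hy0')
  rw [he.2 y hey, map_zero] at hy0
  exact lt_irrefl _ hy0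

end Completion

theorem theorem4 {X C U : Type*}
    [AddCommGroup X] [Module ℝ X] [ConditionallyCompleteLattice X] [IsOrderedAddMonoid X]
    [IsOrderedModule ℝ X]
    [AddCommMonoid C] [Module ℝ≥0 C] [Lattice C]
    [AddCommGroup U] [Module ℝ U] [ConditionallyCompleteLattice U] [IsOrderedAddMonoid U]
    [IsOrderedModule ℝ U]
    (ι : X → C) (hι : IsSupCompletion ι)
    (j : X →ₗ[ℝ] U) (hj : IsUniversalCompletion j)
    (e : X) (he : IsWeakUnit e) (u : C) :
    ¬ LiesInUniversalCompletion ι j u ↔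
      0 < ⨅ t : Set.Ioi (0 : ℝ),
        bandProjection (principalBand ι ((u + ι (-((t : ℝ) • e))) ⊔ 0)) e := by
  set Q : Set.Ioi (0 : ℝ) → X := fun t =>
    bandProjection (principalBand ι ((u + ι (-((t : ℝ) • e))) ⊔ 0)) e with hQ
  have hQ0 : ∀ t, 0 ≤ Q t := fun t => bandProjection_nonneg _ he.1
  have hbdd : BddBelow (Set.range Q) := ⟨0, by rintro _ ⟨t, rfl⟩; exact hQ0 t⟩
  have : Nonempty (Set.Ioi (0 : ℝ)) := ⟨⟨1, Set.mem_Ioi.2 one_pos⟩⟩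
  constructor
  · intro hu
    refine lt_of_le_of_ne (le_ciInf hQ0) fun h0 => hu ?_
    refine liesInUniversalCompletion_of_bddAbove hι hj (bddAbove_of_forall_le_bandProjection hι hj he ?_)
    intro y hy
    rw [h0]
    refine le_ciInf fun t => ?_
    obtain ⟨n, hn⟩ := exists_nat_ge (t : ℝ)
    refine (hy n).trans (bandProjection_spectral_anti hι u ?_ he.1)
    rw [← Nat.cast_smul_eq_nsmul ℝ]
    exact smul_le_smul_of_nonneg_right hn he.1
  · intro hpos hu
    refine hpos.not_ge (hu.nonpos_of_forall_le hι hj he.1 fun n => ?_)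
    have h := ciInf_le hbdd ⟨((n + 1 : ℕ) : ℝ), Set.mem_Ioi.2 (Nat.cast_pos.2 n.succ_pos)⟩
    simpa only [hQ, Nat.cast_smul_eq_nsmul] using h
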